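/- Let $p,\alpha,\beta\in\mathbb R$ with $0\le p\le 1$ and $\alpha^2+\beta^2=1$. For $\vec x,\vec y\in\mathbb R^3$ and $T=(t_{ij})\in\mathbb R^{3\times3}$ write $\{\vec x,\vec y,T\}=\frac14\big(I\otimes I+\sum_i(x_i\,\sigma_i\otimes I+y_i\,I\otimes\sigma_i)+\sum_{i,j}t_{ij}\,\sigma_i\otimes\sigma_j\big)$, where $\sigma_1,\sigma_2,\sigma_3$ are the Pauli matrices. The Werner-like state of qubits $1,2$ is $\rho^w_{12}=\{\vec x^w,\vec x^w,T^w\}$ with $\vec x^w=(0,0,p(\alpha^2-\beta^2))$ and $T^w=\mathrm{diag}(2p\alpha\beta,-2p\alpha\beta,p)$. A nonlocal optimal state-independent Buzek–Hillery (B-H) cloner is a unitary $U$ on $\mathbb C^4\otimes\mathbb C^4\otimes\mathcal K$ (input qubits $1,2$; blank qubits $3,4$; a finite-dimensional machine space $\mathcal K$) such that, for a unit vector $|\xi\rangle\in\mathcal K$ and with $|\Psi_1\rangle,\dots,|\Psi_4\rangle=|00\rangle,|01\rangle,|10\rangle,|11\rangle$, $$U|\Psi_i\rangle|00\rangle|\xi\rangle=\sqrt{\tfrac25}\,|\Psi_i\rangle|\Psi_i\rangle|X_{ii}\rangle+\sqrt{\tfrac1{10}}\sum_{j\ne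 i}\big(|\Psi_i\rangle|\Psi_j\rangle+|\Psi_j\rangle|\Psi_i\rangle\big)|Y_{ij}\rangle ,$$ where, for all $i\ne j$, $\langle X_{ii}|X_{ii}\rangle=\langle Y_{ij}|Y_{ij}\rangle=\langle X_{ii}|Y_{ji}\rangle=1$ and $\langle X_{ii}|Y_{ij}\rangle=\langle Y_{ji}|Y_{ij}\rangle=\langle X_{ii}|X_{jj}\rangle=0$. Apply such a $U$ to $\rho^w_{12}\otimes|00\rangle\langle00|\otimes|\xi\rangle\langle\xi|$, trace out the machine, and let $\tilde\rho_{ab}$ be the reduced state of qubits $a,b$ of the resulting four-qubit state. A state is separable if it is a convex combination of product states, and entangled otherwise. The state $\rho^w_{12}$ is broadcast optimally if $\rho^w_{12}$, $\tilde\rho_{12}$ and $\tilde\rho_{34}$ are entangled and $\tilde\rho_{13}$ and $\tilde\rho_{24}$ are separable. Then $\tilde\rho_{12}=\tilde\rho_{34}=\{\frac35\vec x^w,\frac35\vec x^w,\frac35T^w\}$ and $\tilde\rho_{13}=\tilde\rho_{24}=\{\frac35\vec x^w,\frac35\vec x^w,\frac15 I_3\}$. Moreover: 1. $\tilde\rho_{12}$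 (equivalently $\tilde\rho_{34}$) is entangled if and only if $$\tfrac59<p\le1\quad\text{and}\quad H_-<\alpha^2<H_+,\qquad H_\pm=\tfrac12\pm\sqrt{\frac{27p^2+30p-25}{144\,p^2}}.\tag{$*$}$$ 2. With $\xi_\pm=\frac16(3\pm2\sqrt2)$, $\tilde\rho_{13}$ (equivalently $\tilde\rho_{24}$) is separable if and only if either $\xi_-<\alpha^2\le\xi_+$, or ($\alpha^2\le\xi_-$ or $\alpha^2>\xi_+$) and $p\le\sqrt{\frac{8}{9(1-2\alpha^2)^2}}$. In particular $\tilde\rho_{13}$ and $\tilde\rho_{24}$ are separable whenever $(*)$ holds. 3. $\rho^w_{12}$ is broadcast optimally if and only if $(*)$ holds. -/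

import Mathlib

open scoped Kronecker ComplexOrder Matrix

noncomputable section

namespace BHBroadcast

/-! ### States, separability and reduced states -/

/-- A density matrix: positive semidefinite of trace one. -/
def IsDensityMatrix {n : Type*} [Fintype n] (ρ : Matrix n n ℂ) : Prop :=
  ρ.PosSemidef ∧ ρ.trace = 1

/-- A bipartite state is separable if it is a (finite) convex combination of product states. -/
def IsSeparable {m n : Type*} [Fintype m] [Fintype n] (ρ : Matrix (m × n) (m × n) ℂ) : Prop :=
  ρ ∈ convexHull ℝ {τ : Matrix (m × n) (m × n) ℂ |
    ∃ (A : Matrix m m ℂ) (B : Matrix n n ℂ),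
      IsDensityMatrix A ∧ IsDensityMatrix B ∧ τ = A ⊗ₖ B}

/-- A bipartite state is entangled (inseparable) if it is a state that is not separable. -/
def IsEntangled {m n : Type*} [Fintype m] [Fintype n] (ρ : Matrix (m × n) (m × n) ℂ) : Prop :=
  IsDensityMatrix ρ ∧ ¬ IsSeparable ρ

/-- Partial trace over the right tensor factor. -/
def traceRight {m n : Type*} [Fintype n] (ρ : Matrix (m × n) (m × n) ℂ) : Matrix m m ℂ :=
  Matrix.of fun i j => ∑ k, ρ (i, k) (j, k)

/-- Partial trace over the left tensor factor. -/
def traceLeft {m n : Type*} [Fintype m] (ρ : Matrix (m × n) (m × n) ℂ) : Matrix n n ℂ :=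
  Matrix.of fun i j => ∑ k, ρ (k, i) (k, j)

/-- Index set of the computational basis of two qubits. -/
abbrev TwoQubit : Type := Fin 2 × Fin 2

/-- Operators on the four qubits `1, 2, 3, 4`; a basis index is `((a₁, a₂), (a₃, a₄))`. -/
abbrev FourQubitMatrix : Type := Matrix (TwoQubit × TwoQubit) (TwoQubit × TwoQubit) ℂ

/-- Reduced state of qubits `1, 2`: trace out qubits `3, 4`. -/
def reduced12 (τ : FourQubitMatrix) : Matrix TwoQubit TwoQubit ℂ := traceRight τ

/-- Reduced state of qubits `3, 4`: trace out qubits `1, 2`. -/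
def reduced34 (τ : FourQubitMatrix) : Matrix TwoQubit TwoQubit ℂ := traceLeft τ

/-- Reduced state of qubits `1, 3`: trace out qubits `2, 4`. -/
def reduced13 (τ : FourQubitMatrix) : Matrix TwoQubit TwoQubit ℂ :=
  Matrix.of fun i j => ∑ k : Fin 2, ∑ l : Fin 2, τ ((i.1, k), (i.2, l)) ((j.1, k), (j.2, l))

/-- Reduced state of qubits `2, 4`: trace out qubits `1, 3`. -/
def reduced24 (τ : FourQubitMatrix) : Matrix TwoQubit TwoQubit ℂ :=
  Matrix.of fun i j => ∑ k : Fin 2, ∑ l : Fin 2, τ ((k, i.1), (l, i.2)) ((k, j.1), (l, j.2))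

/-! ### Bloch representation and Werner-like states -/

/-- The Pauli matrices `σ₁, σ₂, σ₃`. -/
def pauli : Fin 3 → Matrix (Fin 2) (Fin 2) ℂ :=
  ![!![0, 1; 1, 0], !![0, -Complex.I; Complex.I, 0], !![1, 0; 0, -1]]

/-- The two-qubit operator `{x, y, T}`, that is
`(1/4) (I ⊗ I + ∑ᵢ (xᵢ σᵢ ⊗ I + yᵢ I ⊗ σᵢ) + ∑ᵢⱼ tᵢⱼ σᵢ ⊗ σⱼ)`. -/
def blochState (x y : Fin 3 → ℝ) (T : Matrix (Fin 3) (Fin 3) ℝ) : Matrix TwoQubit TwoQubit ℂ :=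
  (1 / 4 : ℂ) • (1
    + ∑ i, ((x i : ℂ) • (pauli i ⊗ₖ (1 : Matrix (Fin 2) (Fin 2) ℂ))
        + (y i : ℂ) • ((1 : Matrix (Fin 2) (Fin 2) ℂ) ⊗ₖ pauli i))
    + ∑ i, ∑ j, (T i j : ℂ) • (pauli i ⊗ₖ pauli j))

/-- Bloch vector of the Werner-like state. -/
def wernerVec (p α β : ℝ) : Fin 3 → ℝ := ![0, 0, p * (α ^ 2 - β ^ 2)]

/-- Correlation matrix of the Werner-like state. -/
def wernerCorr (p α β : ℝ) : Matrix (Fin 3) (Fin 3) ℝ :=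
  Matrix.diagonal ![2 * p * α * β, -(2 * p * α * β), p]

/-- The Werner-like state. -/
def wernerLike (p α β : ℝ) : Matrix TwoQubit TwoQubit ℂ :=
  blochState (wernerVec p α β) (wernerVec p α β) (wernerCorr p α β)

/-! ### The optimal state-independent Buzek-Hillery cloner -/

/-- Computational basis vector. -/
def ket {ι : Type*} [DecidableEq ι] (i : ι) : ι → ℂ := Pi.single i 1

/-- Tensor product of vectors. -/
def tensorVec {ι κ : Type*} (u : ι → ℂ) (v : κ → ℂ) : ι × κ → ℂ := fun q => u q.1 * v q.2

/-- Hermitian inner product `⟨u|v⟩` (conjugate-linear in `u`). -/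
def braket {κ : Type*} [Fintype κ] (u v : κ → ℂ) : ℂ := star u ⬝ᵥ v

/-- `U` is an optimal state-independent Buzek-Hillery cloning unitary for an `M`-level system,
`M = card ι`, acting on (input, blank copy, machine), with blank state `|blank⟩`, initial machine
state `ξ` and final machine states `X i` (for `X_{ii}`) and `Y i j` (used for `i ≠ j` only):
`U |i⟩|blank⟩|ξ⟩ = c |i⟩|i⟩|X_{ii}⟩ + d ∑_{j ≠ i} (|i⟩|j⟩ + |j⟩|i⟩)|Y_{ij}⟩`, where
`c = √(2/(M+1))` and `d = √(1/(2(M+1)))`. -/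
structure IsOptimalBHCloner {ι κ : Type*} [Fintype ι] [DecidableEq ι] [Fintype κ] [DecidableEq κ]
    (blank : ι) (ξ : κ → ℂ) (X : ι → κ → ℂ) (Y : ι → ι → κ → ℂ)
    (U : Matrix ((ι × ι) × κ) ((ι × ι) × κ) ℂ) : Prop where
  unitary : U ∈ Matrix.unitaryGroup ((ι × ι) × κ) ℂ
  machine_unit : braket ξ ξ = 1
  X_unit : ∀ i, braket (X i) (X i) = 1
  Y_unit : ∀ i j, i ≠ j → braket (Y i j) (Y i j) = 1
  X_Y_one : ∀ i j, i ≠ j → braket (X i) (Y j i) = 1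
  X_Y_zero : ∀ i j, i ≠ j → braket (X i) (Y i j) = 0
  Y_Y_zero : ∀ i j, i ≠ j → braket (Y j i) (Y i j) = 0
  X_X_zero : ∀ i j, i ≠ j → braket (X i) (X j) = 0
  transform : ∀ i,
    U *ᵥ tensorVec (tensorVec (ket i) (ket blank)) ξ =
      ((√(2 / ((Fintype.card ι : ℝ) + 1)) : ℝ) : ℂ) • tensorVec (tensorVec (ket i) (ket i)) (X i)
      + ((√(1 / (2 * ((Fintype.card ι : ℝ) + 1))) : ℝ) : ℂ) •
        ∑ j ∈ Finset.univ.filter (fun j => j ≠ i),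
          tensorVec (tensorVec (ket i) (ket j) + tensorVec (ket j) (ket i)) (Y i j)

/-- The joint state of the two copies, for input `ρ`: apply `U` to
`ρ ⊗ |blank⟩⟨blank| ⊗ |ξ⟩⟨ξ|` and trace out the machine. -/
def cloneOutput {ι κ : Type*} [Fintype ι] [DecidableEq ι] [Fintype κ]
    (blank : ι) (ξ : κ → ℂ) (U : Matrix ((ι × ι) × κ) ((ι × ι) × κ) ℂ) (ρ : Matrix ι ι ℂ) :
    Matrix (ι × ι) (ι × ι) ℂ :=
  traceRight (U * ((ρ ⊗ₖ Matrix.vecMulVec (ket blank) (star (ket blank))) ⊗ₖ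
    Matrix.vecMulVec ξ (star ξ)) * Uᴴ)

/-- Nonlocal optimal broadcasting: the state `ρ` of qubits `1, 2` is entangled, and the four-qubit
state `τ` obtained from it by nonlocal cloning has entangled desired outputs `12`, `34` and
separable remaining outputs `13`, `24`. -/
def IsBroadcastOptimally (ρ : Matrix TwoQubit TwoQubit ℂ) (τ : FourQubitMatrix) : Prop :=
  IsEntangled ρ ∧ IsEntangled (reduced12 τ) ∧ IsEntangled (reduced34 τ) ∧
    IsSeparable (reduced13 τ) ∧ IsSeparable (reduced24 τ)

/-- The endpoint `H₋`. -/
def Hminus (p : ℝ) : ℝ := 1 / 2 - √((27 * p ^ 2 + 30 * p - 25) / (144 * p ^ 2))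

/-- The endpoint `H₊`. -/
def Hplus (p : ℝ) : ℝ := 1 / 2 + √((27 * p ^ 2 + 30 * p - 25) / (144 * p ^ 2))

/-- The parameter region `5/9 < p ≤ 1`, `H₋ < α² < H₊`. -/
def InRegion (p α : ℝ) : Prop :=
  5 / 9 < p ∧ p ≤ 1 ∧ Hminus p < α ^ 2 ∧ α ^ 2 < Hplus p

/-- The endpoint `ξ₋ = (3 - 2√2)/6`. -/
def xiMinus : ℝ := (3 - 2 * √2) / 6

/-- The endpoint `ξ₊ = (3 + 2√2)/6`. -/
def xiPlus : ℝ := (3 + 2 * √2) / 6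

/-- The separability range of the remaining outputs, for `0 ≤ p ≤ 1` and `0 ≤ α² ≤ 1`:
`p ≤ √(8 / (9 (1 - 2α²)²))` and (`α² ≤ ξ₋` or `ξ₊ < α²`), or `ξ₋ < α² ≤ ξ₊`. -/
def InSeparabilityRange (p α : ℝ) : Prop :=
  (p ≤ √(8 / (9 * (1 - 2 * α ^ 2) ^ 2)) ∧ (α ^ 2 ≤ xiMinus ∨ xiPlus < α ^ 2)) ∨
    (xiMinus < α ^ 2 ∧ α ^ 2 ≤ xiPlus)

end BHBroadcast

end

/-!
The inner products of the machine states force `Y i j = X j`, with the `X j` orthonormal. Since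
`√(2/(M+1)) = 2 √(1/(2(M+1)))`, the cloner then acts by
`|i⟩ ↦ √(1/(2(M+1))) ∑ⱼ (|i⟩|j⟩ + |j⟩|i⟩) |X j⟩`, the term `j = i` included. Tracing out the machine
gives, up to the normalisation, `(1 + S) (ρ ⊗ I) (1 + S)` with `S` the swap of the two copies
(`IsOptimalBHCloner.cloneOutput_apply`), from which the reduced states are read off: a single clone
of a Werner-like state of weight `p` is the Werner-like state of weight `3p/5`, and the pairs `13`
and `24` carry an explicit state depending on `m = p (α² - β²)` alone.

All of these are, possibly after a partial transpose, states whose only coherence `w` is real and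
sits between `00` and `11` (`xState`). Such a state with diagonal `a, b, c, d` is separable if and
only if `w² ≤ a d` and `w² ≤ b c` (`isSeparable_xState_iff`). Necessity holds because separable
states and their partial transposes are positive semidefinite. For sufficiency, averaging a product
vector over four opposite local phases leaves exactly one coherence, and the product vector can be
chosen so that a diagonal product operator makes up the difference. As the partial transpose
preserves separability, the same criterion covers the pairs `13` and `24`.

For the clones the criterion fails exactly when `1 - q < 4 q |α β|` with `q = 3p/5`; for the pairs
`13` and `24` it says `m² ≤ 8/9`. The rest compares these inequalities with the given ranges
(`inRegion_iff`, `inSeparabilityRange_iff`).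
-/

namespace BHBroadcast

/-! ### The output of the cloner -/

/-- Two unit vectors with inner product one are equal. -/
theorem eq_of_braket_eq_one {κ : Type*} [Fintype κ] {u v : κ → ℂ} (hu : braket u u = 1)
    (hv : braket v v = 1) (huv : braket u v = 1) : u = v := by
  have hvu : star v ⬝ᵥ u = 1 := by
    rw [braket] at huv
    rw [Matrix.star_dotProduct, huv, star_one]
  rw [← sub_eq_zero, ← dotProduct_star_self_eq_zero]
  simp only [braket] at hu hv huv
  simp [sub_dotProduct, dotProduct_sub, hu, hv, huv, hvu]

section Cloner

variable {ι κ : Type*} [Fintype ι] [DecidableEq ι] [Fintype κ] [DecidableEq κ]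
  {blank : ι} {ξ : κ → ℂ} {X : ι → κ → ℂ} {Y : ι → ι → κ → ℂ}
  {U : Matrix ((ι × ι) × κ) ((ι × ι) × κ) ℂ}

theorem IsOptimalBHCloner.Y_eq_X (hU : IsOptimalBHCloner blank ξ X Y U) {i j : ι} (hij : i ≠ j) :
    Y i j = X j :=
  (eq_of_braket_eq_one (hU.X_unit j) (hU.Y_unit i j hij) (hU.X_Y_one j i hij.symm)).symm

theorem IsOptimalBHCloner.sum_X_mul_star_X (hU : IsOptimalBHCloner blank ξ X Y U) (i j : ι) :
    ∑ k, X i k * star (X j k) = (1 : Matrix ι ι ℂ) i j := by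
  have h : ∑ k, X i k * star (X j k) = braket (X j) (X i) := by
    simp [braket, dotProduct, mul_comm]
  rw [h]
  by_cases hij : i = j
  · subst hij; simp [hU.X_unit]
  · rw [hU.X_X_zero j i (Ne.symm hij), Matrix.one_apply_ne hij]

/-- The amplitudes of a cloned basis state. Since `√(2/(M+1)) = 2 √(1/(2(M+1)))`, the term
`|i⟩|i⟩|X i⟩` has the shape `(|i⟩|j⟩ + |j⟩|i⟩)|X j⟩` of the others. -/
theorem IsOptimalBHCloner.mulVec_apply (hU : IsOptimalBHCloner blank ξ X Y U) (i a b : ι) (k : κ) :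
    (U *ᵥ tensorVec (tensorVec (ket i) (ket blank)) ξ) ((a, b), k) =
      ((√(1 / (2 * ((Fintype.card ι : ℝ) + 1))) : ℝ) : ℂ) *
        ((1 : Matrix ι ι ℂ) a i * X b k + (1 : Matrix ι ι ℂ) b i * X a k) := by
  have hc : √(2 / ((Fintype.card ι : ℝ) + 1)) =
      √(1 / (2 * ((Fintype.card ι : ℝ) + 1))) * 2 := by
    rw [show (2 : ℝ) / ((Fintype.card ι : ℝ) + 1) =
      1 / (2 * ((Fintype.card ι : ℝ) + 1)) * 2 ^ 2 by field_simp,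
      Real.sqrt_mul (by positivity), Real.sqrt_sq (by norm_num)]
  have hY : ∑ j ∈ Finset.univ.filter (fun j => j ≠ i),
      tensorVec (tensorVec (ket i) (ket j) + tensorVec (ket j) (ket i)) (Y i j) =
      ∑ j, (if j = i then 0 else
        tensorVec (tensorVec (ket i) (ket j) + tensorVec (ket j) (ket i)) (X j)) := by
    rw [Finset.sum_filter]
    refine Finset.sum_congr rfl fun j _ => ?_
    by_cases hj : j = i
    · simp [hj]
    · simp [hj, hU.Y_eq_X (Ne.symm hj)]
  rw [hU.transform, hc, hY]
  have hsum : (∑ j, (if j = i then 0 else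
        tensorVec (tensorVec (ket i) (ket j) + tensorVec (ket j) (ket i)) (X j))) ((a, b), k) =
      (if b = i then 0 else (1 : Matrix ι ι ℂ) a i * X b k) +
        (if a = i then 0 else (1 : Matrix ι ι ℂ) b i * X a k) := by
    have hterm : ∀ j, (if j = i then 0 else tensorVec (tensorVec (ket i) (ket j) +
        tensorVec (ket j) (ket i)) (X j)) ((a, b), k) =
        (if b = j then (if b = i then 0 else (1 : Matrix ι ι ℂ) a i * X b k) else 0) +
        (if a = j then (if a = i then 0 else (1 : Matrix ι ι ℂ) b i * X a k) else 0) := by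
      intro j
      by_cases h1 : j = i <;> by_cases h2 : b = j <;> by_cases h3 : a = j <;>
        simp_all [tensorVec, ket, Pi.single_apply, Matrix.one_apply]
    rw [Finset.sum_apply, Finset.sum_congr rfl fun j _ => hterm j, Finset.sum_add_distrib]
    simp
  simp only [Pi.add_apply, Pi.smul_apply, hsum, smul_eq_mul]
  by_cases ha : a = i <;> by_cases hb : b = i <;>
    (simp [tensorVec, ket, Matrix.one_apply, ha, hb]; try ring)

/-- The joint state of the two clones of `ρ` is a multiple of `(1 + S) (ρ ⊗ I) (1 + S)`, where `S`
swaps the two copies; here it is written out entrywise. -/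
theorem IsOptimalBHCloner.cloneOutput_apply (hU : IsOptimalBHCloner blank ξ X Y U)
    (ρ : Matrix ι ι ℂ) (a a' b b' : ι) :
    cloneOutput blank ξ U ρ (a, a') (b, b') =
      (1 / (2 * ((Fintype.card ι : ℂ) + 1))) *
        (ρ a b * (1 : Matrix ι ι ℂ) a' b' + ρ a b' * (1 : Matrix ι ι ℂ) a' b +
          ρ a' b * (1 : Matrix ι ι ℂ) a b' + ρ a' b' * (1 : Matrix ι ι ℂ) a b) := by
  set e : ι → (ι × ι) × κ → ℂ := fun i => tensorVec (tensorVec (ket i) (ket blank)) ξ with he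
  have hin : (ρ ⊗ₖ Matrix.vecMulVec (ket blank) (star (ket blank))) ⊗ₖ
      Matrix.vecMulVec ξ (star ξ) = ∑ i, ∑ j, ρ i j • Matrix.vecMulVec (e i) (star (e j)) := by
    ext ⟨⟨x, y⟩, k⟩ ⟨⟨x', y'⟩, k'⟩
    simp only [Matrix.kroneckerMap_apply, Matrix.sum_apply, Matrix.smul_apply, he,
      Matrix.vecMulVec_apply, Pi.star_apply, tensorVec, ket, smul_eq_mul, star_mul']
    rw [Finset.sum_eq_single x, Finset.sum_eq_single x']
    · simp only [Pi.single_eq_same, star_one]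
      ring
    · intro j _ hj
      simp [Pi.single_eq_of_ne hj.symm]
    · simp
    · intro i _ hi
      simp [Pi.single_eq_of_ne hi.symm]
    · simp
  have hout : U * ((ρ ⊗ₖ Matrix.vecMulVec (ket blank) (star (ket blank))) ⊗ₖ
      Matrix.vecMulVec ξ (star ξ)) * Uᴴ =
      ∑ i, ∑ j, ρ i j • Matrix.vecMulVec (U *ᵥ e i) (star (U *ᵥ e j)) := by
    rw [hin]
    simp only [Matrix.mul_sum, Matrix.sum_mul, Matrix.mul_smul, Matrix.smul_mul,
      Matrix.mul_vecMulVec, Matrix.vecMulVec_mul, Matrix.star_mulVec]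
  have hd : ((√(1 / (2 * ((Fintype.card ι : ℝ) + 1))) : ℝ) : ℂ) *
      ((√(1 / (2 * ((Fintype.card ι : ℝ) + 1))) : ℝ) : ℂ) =
      1 / (2 * ((Fintype.card ι : ℂ) + 1)) := by
    rw [← Complex.ofReal_mul, Real.mul_self_sqrt (by positivity)]
    push_cast; ring
  have hδ : ∀ i j, star ((1 : Matrix ι ι ℂ) i j) = (1 : Matrix ι ι ℂ) i j := fun i j => by
    by_cases h : i = j <;> simp [Matrix.one_apply, h]
  have hcollapse : ∀ x y z t : ℂ, ∑ i, ∑ j, ρ i j *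
      (((1 : Matrix ι ι ℂ) a i * x + (1 : Matrix ι ι ℂ) a' i * y) *
        ((1 : Matrix ι ι ℂ) b j * z + (1 : Matrix ι ι ℂ) b' j * t)) =
      ρ a b * (x * z) + ρ a b' * (x * t) + ρ a' b * (y * z) + ρ a' b' * (y * t) := by
    intro x y z t
    simp only [mul_add, add_mul, Finset.sum_add_distrib, Matrix.one_apply, ite_mul, mul_ite,
      zero_mul, mul_zero, one_mul, Finset.sum_ite_eq, Finset.mem_univ, if_true]
    ring
  have hentry : ∀ k, (∑ i, ∑ j, ρ i j • Matrix.vecMulVec (U *ᵥ e i) (star (U *ᵥ e j)))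
      ((a, a'), k) ((b, b'), k) = (1 / (2 * ((Fintype.card ι : ℂ) + 1))) *
        (ρ a b * (X a' k * star (X b' k)) + ρ a b' * (X a' k * star (X b k)) +
          ρ a' b * (X a k * star (X b' k)) + ρ a' b' * (X a k * star (X b k))) := by
    intro k
    simp only [Matrix.sum_apply, Matrix.smul_apply, Matrix.vecMulVec_apply, Pi.star_apply, he,
      hU.mulVec_apply, smul_eq_mul, star_mul', star_add, hδ, Complex.star_def, Complex.conj_ofReal]
    rw [← hd, ← hcollapse]
    simp only [Finset.mul_sum]
    refine Finset.sum_congr rfl fun i _ => Finset.sum_congr rfl fun j _ => ?_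
    ring
  simp only [cloneOutput, traceRight, Matrix.of_apply, hout, hentry]
  rw [← Finset.mul_sum]
  simp only [Finset.sum_add_distrib, ← Finset.mul_sum, hU.sum_X_mul_star_X]

/-- The first clone is `ρ` mixed with the identity. -/
theorem IsOptimalBHCloner.traceRight_cloneOutput (hU : IsOptimalBHCloner blank ξ X Y U)
    (ρ : Matrix ι ι ℂ) :
    traceRight (cloneOutput blank ξ U ρ) = (1 / (2 * ((Fintype.card ι : ℂ) + 1))) •
      (((Fintype.card ι : ℂ) + 2) • ρ + ρ.trace • (1 : Matrix ι ι ℂ)) := by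
  ext a b
  simp only [traceRight, Matrix.of_apply, hU.cloneOutput_apply, ← Finset.mul_sum,
    Finset.sum_add_distrib, Matrix.smul_apply, Matrix.add_apply, smul_eq_mul]
  simp [Matrix.one_apply, Matrix.trace]
  left; ring

/-- The two clones are in the same state. -/
theorem IsOptimalBHCloner.traceLeft_cloneOutput (hU : IsOptimalBHCloner blank ξ X Y U)
    (ρ : Matrix ι ι ℂ) :
    traceLeft (cloneOutput blank ξ U ρ) = traceRight (cloneOutput blank ξ U ρ) := by
  ext a b
  simp only [traceRight, traceLeft, Matrix.of_apply, hU.cloneOutput_apply]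
  refine Finset.sum_congr rfl fun k _ => ?_
  ring

end Cloner

/-! ### Separability and the partial transpose -/

theorem IsDensityMatrix.transpose {n : Type*} [Fintype n] {A : Matrix n n ℂ}
    (hA : IsDensityMatrix A) : IsDensityMatrix Aᵀ :=
  ⟨hA.1.transpose, by rw [Matrix.trace_transpose, hA.2]⟩

/-- Partial transpose in the right tensor factor. -/
def partialTranspose {m n : Type*} (ρ : Matrix (m × n) (m × n) ℂ) : Matrix (m × n) (m × n) ℂ :=
  Matrix.of fun i j => ρ (i.1, j.2) (j.1, i.2)

theorem partialTranspose_kronecker {m n : Type*} (A : Matrix m m ℂ) (B : Matrix n n ℂ) :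
    partialTranspose (A ⊗ₖ B) = A ⊗ₖ Bᵀ := rfl

theorem isLinearMap_partialTranspose {m n : Type*} :
    IsLinearMap ℝ (partialTranspose (m := m) (n := n)) :=
  ⟨fun _ _ => rfl, fun _ _ => rfl⟩

section Separable

variable {m n : Type*} [Fintype m] [Fintype n] {ρ : Matrix (m × n) (m × n) ℂ}

theorem IsSeparable.posSemidef (hρ : IsSeparable ρ) : ρ.PosSemidef := by
  have hconv : Convex ℝ {τ : Matrix (m × n) (m × n) ℂ | τ.PosSemidef} := by
    intro σ hσ τ hτ a b ha hb _
    exact (hσ.smul ha).add (hτ.smul hb)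
  refine convexHull_min ?_ hconv hρ
  rintro _ ⟨A, B, hA, hB, rfl⟩
  exact hA.1.kronecker hB.1

theorem IsSeparable.partialTranspose (hρ : IsSeparable ρ) :
    IsSeparable (partialTranspose ρ) := by
  have h := Set.mem_image_of_mem BHBroadcast.partialTranspose hρ
  rw [isLinearMap_partialTranspose.image_convexHull] at h
  refine convexHull_mono ?_ h
  rintro _ ⟨_, ⟨A, B, hA, hB, rfl⟩, rfl⟩
  exact ⟨A, Bᵀ, hA, hB.transpose, partialTranspose_kronecker A B⟩

theorem isSeparable_partialTranspose_iff :
    IsSeparable (BHBroadcast.partialTranspose ρ) ↔ IsSeparable ρ :=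
  ⟨fun h => h.partialTranspose, fun h => h.partialTranspose⟩

/-- A positive semidefinite matrix is a nonnegative multiple of a density matrix. -/
theorem exists_smul_isDensityMatrix [DecidableEq n] [Nonempty n] {A : Matrix n n ℂ}
    (hA : A.PosSemidef) :
    ∃ (r : ℝ) (B : Matrix n n ℂ), 0 ≤ r ∧ IsDensityMatrix B ∧ A = r • B := by
  have htr := hA.trace_nonneg
  obtain ⟨hre, him⟩ := Complex.nonneg_iff.1 htr
  have hAr : A.trace = (A.trace.re : ℂ) := Complex.ext rfl (by simpa using him.symm)
  rcases hre.eq_or_lt with h | h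
  · have hA0 : A = 0 := hA.trace_eq_zero_iff.1 (by rw [hAr, ← h]; simp)
    obtain ⟨i⟩ := ‹Nonempty n›
    refine ⟨0, Matrix.diagonal (Pi.single i 1), le_rfl,
      ⟨Matrix.PosSemidef.diagonal (Pi.single_nonneg.2 zero_le_one), ?_⟩, by simp [hA0]⟩
    simp [Matrix.trace_diagonal]
  · refine ⟨A.trace.re, A.trace.re⁻¹ • A, h.le, ⟨hA.smul (inv_nonneg.2 h.le), ?_⟩, ?_⟩
    · rw [Matrix.trace_smul, hAr, Complex.ofReal_re, Complex.real_smul, ← Complex.ofReal_mul,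
        inv_mul_cancel₀ h.ne', Complex.ofReal_one]
    · rw [smul_smul, mul_inv_cancel₀ h.ne', one_smul]

/-- A sum of products of positive semidefinite operators is separable once it has trace one. -/
theorem isSeparable_of_eq_sum [DecidableEq m] [Nonempty m] [DecidableEq n] [Nonempty n]
    {ι : Type*} [Fintype ι] (A : ι → Matrix m m ℂ) (B : ι → Matrix n n ℂ)
    (hA : ∀ i, (A i).PosSemidef) (hB : ∀ i, (B i).PosSemidef)
    (hρ : ρ = ∑ i, A i ⊗ₖ B i) (htr : ρ.trace = 1) : IsSeparable ρ := by
  choose r A' hr hA' hAr using fun i => exists_smul_isDensityMatrix (hA i)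
  choose s B' hs hB' hBs using fun i => exists_smul_isDensityMatrix (hB i)
  have hρ' : ρ = ∑ i, (r i * s i) • (A' i ⊗ₖ B' i) := by
    rw [hρ]
    refine Finset.sum_congr rfl fun i _ => ?_
    rw [hAr i, hBs i, Matrix.smul_kronecker, Matrix.kronecker_smul, smul_smul]
  have hsum : ∑ i, r i * s i = 1 := by
    rw [hρ', Matrix.trace_sum] at htr
    simp only [Matrix.trace_smul, Matrix.trace_kronecker, (hA' _).2, (hB' _).2] at htr
    have := congrArg Complex.re htr
    simpa using this
  rw [hρ']
  exact (convex_convexHull ℝ _).sum_mem (fun i _ => mul_nonneg (hr i) (hs i)) hsum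
    fun i _ => subset_convexHull ℝ _ ⟨A' i, B' i, hA' i, hB' i, rfl⟩

end Separable

/-! ### Two-qubit states with a single coherence -/

/-- The two-qubit operator with diagonal `a, b, c, d` in the basis `00, 01, 10, 11` and a real
coherence `w` between `00` and `11`. -/
def xState (a b c d w : ℝ) : Matrix TwoQubit TwoQubit ℂ :=
  Matrix.of fun i j =>
    if i = j then
      (if i = (0, 0) then (a : ℂ) else if i = (0, 1) then b else if i = (1, 0) then c else d)
    else if i = (0, 0) ∧ j = (1, 1) ∨ i = (1, 1) ∧ j = (0, 0) then w else 0

theorem trace_xState (a b c d w : ℝ) : (xState a b c d w).trace = ((a + b + c + d : ℝ) : ℂ) := by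
  simp [xState, Matrix.trace, Fintype.sum_prod_type]
  ring

/-- A principal `2 × 2` minor of a positive semidefinite matrix with real entries. -/
theorem sq_le_mul_of_posSemidef {n : Type*} {A : Matrix n n ℂ} (hA : A.PosSemidef) {i j : n}
    {x y z : ℝ} (hx : A i i = x) (hy : A j j = y) (hz : A i j = z) : z ^ 2 ≤ x * y := by
  have h := (hA.submatrix ![i, j]).det_nonneg
  have hz' : A j i = z := by rw [← hA.1.apply j i, hz]; simp
  rw [Matrix.det_fin_two] at h
  simp only [Matrix.submatrix_apply, Matrix.cons_val_zero, Matrix.cons_val_one, hx, hy, hz, hz'] at h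
  have := (Complex.nonneg_iff.1 h).1
  simp at this
  nlinarith

/-- Averaging the product vectors `(1, iᵏ s) ⊗ (√a, (-i)ᵏ √b)` over the four phases kills every
coherence except the one between `00` and `11`. -/
theorem isSeparable_xState {a b c d w : ℝ} (ha : 0 ≤ a) (hb : 0 ≤ b) (hc : 0 ≤ c) (hd : 0 ≤ d)
    (htr : a + b + c + d = 1) (had : w ^ 2 ≤ a * d) (hbc : w ^ 2 ≤ b * c) :
    IsSeparable (xState a b c d w) := by
  -- the scale `s` puts `s √a √b = w` into the coherence and at most `c`, `d` onto the diagonal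
  obtain ⟨s, hs, hsc, hsd⟩ : ∃ s : ℝ, s * (√a * √b) = w ∧ s ^ 2 * a ≤ c ∧ s ^ 2 * b ≤ d := by
    by_cases hab : a * b = 0
    · have hw : w = 0 := by
        rcases mul_eq_zero.1 hab with h | h <;> subst h <;> simp_all
      exact ⟨0, by simp [hw], by simpa, by simpa⟩
    · have ha' : 0 < a := lt_of_le_of_ne ha fun h => hab (by simp [← h])
      have hb' : 0 < b := lt_of_le_of_ne hb fun h => hab (by simp [← h])
      have hsa := Real.sqrt_pos.2 ha'
      have hsb := Real.sqrt_pos.2 hb'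
      refine ⟨w / (√a * √b), by field_simp, ?_, ?_⟩
      · rw [div_pow, mul_pow, Real.sq_sqrt ha, Real.sq_sqrt hb, div_mul_eq_mul_div,
          div_le_iff₀ (by positivity)]
        nlinarith
      · rw [div_pow, mul_pow, Real.sq_sqrt ha, Real.sq_sqrt hb, div_mul_eq_mul_div,
          div_le_iff₀ (by positivity)]
        nlinarith
  have hsa : (√a : ℂ) * √a = a := by rw [← Complex.ofReal_mul, Real.mul_self_sqrt ha]
  have hsb : (√b : ℂ) * √b = b := by rw [← Complex.ofReal_mul, Real.mul_self_sqrt hb]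
  have hs' : (w : ℂ) = s * (√a * √b) := by rw [← hs]; push_cast; ring
  let u : Fin 4 → Fin 2 → ℂ := fun k => ![1, Complex.I ^ (k : ℕ) * s]
  let v : Fin 4 → Fin 2 → ℂ := fun k => ![√a, (-Complex.I) ^ (k : ℕ) * √b]
  let A : Option (Fin 4) → Matrix (Fin 2) (Fin 2) ℂ := fun o =>
    o.elim (Matrix.diagonal ![0, 1]) fun k => (1 / 4 : ℝ) • Matrix.vecMulVec (u k) (star (u k))
  let B : Option (Fin 4) → Matrix (Fin 2) (Fin 2) ℂ := fun o =>
    o.elim (Matrix.diagonal ![((c - s ^ 2 * a : ℝ) : ℂ), ((d - s ^ 2 * b : ℝ) : ℂ)])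
      fun k => Matrix.vecMulVec (v k) (star (v k))
  refine isSeparable_of_eq_sum A B ?_ ?_ ?_ (by rw [trace_xState, htr, Complex.ofReal_one])
  · rintro (_ | k)
    · refine Matrix.PosSemidef.diagonal fun i => ?_
      fin_cases i <;> simp
    · exact (Matrix.posSemidef_vecMulVec_self_star _).smul (by norm_num)
  · rintro (_ | k)
    · refine Matrix.PosSemidef.diagonal fun i => ?_
      fin_cases i
      · exact Complex.zero_le_real.2 (sub_nonneg.2 hsc)
      · exact Complex.zero_le_real.2 (sub_nonneg.2 hsd)
    · exact Matrix.posSemidef_vecMulVec_self_star _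
  · have hI3 : Complex.I ^ 3 = -Complex.I := Complex.I_pow_three
    ext ⟨i, i'⟩ ⟨j, j'⟩
    rw [Fintype.sum_option]
    simp only [Matrix.add_apply, Fin.sum_univ_four, Matrix.kroneckerMap_apply, A,
      B, Option.elim, Matrix.smul_apply, Matrix.vecMulVec_apply, Pi.star_apply, u, v]
    fin_cases i <;> fin_cases i' <;> fin_cases j <;> fin_cases j' <;>
      simp [xState, hs', neg_pow Complex.I, hI3]
    all_goals
      try simp only [← hsa, ← hsb]
      ring_nf
      try simp only [Complex.I_sq, Complex.I_pow_four]
      try ring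

/-- The positive partial transpose criterion for these states, which is here necessary and
sufficient. -/
theorem isSeparable_xState_iff {a b c d w : ℝ} (ha : 0 ≤ a) (hb : 0 ≤ b) (hc : 0 ≤ c) (hd : 0 ≤ d)
    (htr : a + b + c + d = 1) :
    IsSeparable (xState a b c d w) ↔ w ^ 2 ≤ a * d ∧ w ^ 2 ≤ b * c := by
  refine ⟨fun h => ⟨?_, ?_⟩, fun h => isSeparable_xState ha hb hc hd htr h.1 h.2⟩
  · exact sq_le_mul_of_posSemidef h.posSemidef (i := (0, 0)) (j := (1, 1))
      (by simp [xState]) (by simp [xState]) (by simp [xState])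
  · exact sq_le_mul_of_posSemidef h.partialTranspose.posSemidef (i := (0, 1)) (j := (1, 0))
      (by simp [xState, partialTranspose]) (by simp [xState, partialTranspose])
      (by simp [xState, partialTranspose])

/-! ### Werner-like states -/

theorem wernerLike_eq_xState {q α β : ℝ} (hαβ : α ^ 2 + β ^ 2 = 1) :
    wernerLike q α β = xState (q * α ^ 2 + (1 - q) / 4) ((1 - q) / 4) ((1 - q) / 4)
      (q * β ^ 2 + (1 - q) / 4) (q * (α * β)) := by
  have h : (β : ℂ) ^ 2 = 1 - (α : ℂ) ^ 2 := by
    rw [eq_sub_iff_add_eq']; exact_mod_cast hαβ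
  ext ⟨i, i'⟩ ⟨j, j'⟩
  simp only [wernerLike, blochState, Matrix.smul_apply, Matrix.add_apply, Fin.sum_univ_three,
    Matrix.kroneckerMap_apply, smul_eq_mul]
  fin_cases i <;> fin_cases i' <;> fin_cases j <;> fin_cases j' <;>
    simp [xState, wernerVec, wernerCorr, pauli]
  all_goals
    try rw [h]
    try ring

theorem isDensityMatrix_wernerLike {q α β : ℝ} (hq₀ : 0 ≤ q) (hq₁ : q ≤ 1)
    (hαβ : α ^ 2 + β ^ 2 = 1) : IsDensityMatrix (wernerLike q α β) := by
  rw [wernerLike_eq_xState hαβ]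
  refine ⟨?_, ?_⟩
  · -- a mixture of the pure state `α|00⟩ + β|11⟩` with the identity
    have h : xState (q * α ^ 2 + (1 - q) / 4) ((1 - q) / 4) ((1 - q) / 4)
        (q * β ^ 2 + (1 - q) / 4) (q * (α * β)) =
        q • Matrix.vecMulVec ((α : ℂ) • ket (0, 0) + (β : ℂ) • ket (1, 1))
          (star ((α : ℂ) • ket (0, 0) + (β : ℂ) • ket (1, 1))) +
        ((1 - q) / 4) • (1 : Matrix TwoQubit TwoQubit ℂ) := by
      ext ⟨i, i'⟩ ⟨j, j'⟩
      fin_cases i <;> fin_cases i' <;> fin_cases j <;> fin_cases j' <;>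
        simp [xState, Matrix.vecMulVec_apply, ket]
      all_goals exact Or.inl (by ring)
    rw [h]
    exact ((Matrix.posSemidef_vecMulVec_self_star _).smul hq₀).add
      (Matrix.PosSemidef.one.smul (by linarith))
  · rw [trace_xState, ← Complex.ofReal_one]
    congr 1
    linear_combination q * hαβ

/-- The condition is `1 - q < 4 q |α β|`. The inequality `w² ≤ a d` between the extreme diagonal
entries holds for every Werner-like state, by positivity; only `w² ≤ b c` can fail. -/
theorem isEntangled_wernerLike_iff {q α β : ℝ} (hq₀ : 0 ≤ q) (hq₁ : q ≤ 1)
    (hαβ : α ^ 2 + β ^ 2 = 1) :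
    IsEntangled (wernerLike q α β) ↔ ((1 - q) / 4) ^ 2 < (q * (α * β)) ^ 2 := by
  have hq : 0 ≤ (1 - q) / 4 := by linarith
  have hα : 0 ≤ q * α ^ 2 := by positivity
  have hβ : 0 ≤ q * β ^ 2 := by positivity
  have had : (q * (α * β)) ^ 2 ≤ (q * α ^ 2 + (1 - q) / 4) * (q * β ^ 2 + (1 - q) / 4) := by
    nlinarith [mul_nonneg hα hq, mul_nonneg hβ hq, mul_nonneg hq hq]
  rw [IsEntangled, and_iff_right (isDensityMatrix_wernerLike hq₀ hq₁ hαβ),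
    wernerLike_eq_xState hαβ, isSeparable_xState_iff (by linarith) hq hq (by linarith)
      (by linear_combination q * hαβ), and_iff_right had, not_le, sq ((1 - q) / 4)]

/-! ### The reduced states of the cloned Werner-like state -/

theorem blochState_smul_werner (r p α β : ℝ) :
    blochState (r • wernerVec p α β) (r • wernerVec p α β) (r • wernerCorr p α β) =
      wernerLike (r * p) α β := by
  have hv : r • wernerVec p α β = wernerVec (r * p) α β := by
    ext i; fin_cases i <;> simp [wernerVec, mul_assoc]
  have hT : r • wernerCorr p α β = wernerCorr (r * p) α β := by
    rw [wernerCorr, wernerCorr, ← Matrix.diagonal_smul]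
    congr 1
    ext i; fin_cases i <;> simp <;> ring
  rw [hv, hT, wernerLike]

/-- The state of two corresponding qubits of the different clones. -/
theorem blochState_smul_one_eq (r p α β : ℝ) :
    blochState (r • wernerVec p α β) (r • wernerVec p α β)
        ((1 / 5 : ℝ) • (1 : Matrix (Fin 3) (Fin 3) ℝ)) =
      partialTranspose (xState (3 / 10 + r / 2 * (p * (α ^ 2 - β ^ 2))) (1 / 5) (1 / 5)
        (3 / 10 - r / 2 * (p * (α ^ 2 - β ^ 2))) (1 / 10)) := by
  ext ⟨i, i'⟩ ⟨j, j'⟩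
  simp only [blochState, Matrix.smul_apply, Matrix.add_apply, Fin.sum_univ_three,
    Matrix.kroneckerMap_apply, smul_eq_mul]
  fin_cases i <;> fin_cases i' <;> fin_cases j <;> fin_cases j' <;>
    simp [partialTranspose, xState, wernerVec, pauli]
  all_goals
    try ring_nf
    try simp
    try ring

section Cloner

variable {κ : Type*} [Fintype κ] [DecidableEq κ] {ξ : κ → ℂ} {X : TwoQubit → κ → ℂ}
  {Y : TwoQubit → TwoQubit → κ → ℂ} {U : Matrix ((TwoQubit × TwoQubit) × κ)
    ((TwoQubit × TwoQubit) × κ) ℂ} {p α β : ℝ}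

/-- Mixing a Werner-like state with the identity only lowers its weight, from `p` to `3p/5`. -/
theorem IsOptimalBHCloner.reduced12_wernerLike (hU : IsOptimalBHCloner ((0, 0) : TwoQubit) ξ X Y U)
    (hαβ : α ^ 2 + β ^ 2 = 1) :
    reduced12 (cloneOutput (0, 0) ξ U (wernerLike p α β)) = wernerLike (3 / 5 * p) α β := by
  have htr : (wernerLike p α β).trace = 1 := by
    rw [wernerLike_eq_xState hαβ, trace_xState, ← Complex.ofReal_one]
    congr 1
    linear_combination p * hαβ
  rw [reduced12, hU.traceRight_cloneOutput, htr, wernerLike_eq_xState hαβ, wernerLike_eq_xState hαβ]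
  ext ⟨i, i'⟩ ⟨j, j'⟩
  fin_cases i <;> fin_cases i' <;> fin_cases j <;> fin_cases j' <;>
    simp [xState]
  all_goals
    try ring

theorem IsOptimalBHCloner.reduced13_wernerLike (hU : IsOptimalBHCloner ((0, 0) : TwoQubit) ξ X Y U)
    (hαβ : α ^ 2 + β ^ 2 = 1) :
    reduced13 (cloneOutput (0, 0) ξ U (wernerLike p α β)) =
      partialTranspose (xState (3 / 10 + 3 / 5 / 2 * (p * (α ^ 2 - β ^ 2))) (1 / 5) (1 / 5)
        (3 / 10 - 3 / 5 / 2 * (p * (α ^ 2 - β ^ 2))) (1 / 10)) := by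
  have h : (β : ℂ) ^ 2 = 1 - (α : ℂ) ^ 2 := by
    rw [eq_sub_iff_add_eq']; exact_mod_cast hαβ
  rw [wernerLike_eq_xState hαβ]
  ext ⟨i, i'⟩ ⟨j, j'⟩
  simp only [reduced13, Matrix.of_apply, Fin.sum_univ_two, hU.cloneOutput_apply]
  fin_cases i <;> fin_cases i' <;> fin_cases j <;> fin_cases j' <;>
    simp [partialTranspose, xState, h]
  all_goals
    try ring

theorem IsOptimalBHCloner.reduced24_wernerLike (hU : IsOptimalBHCloner ((0, 0) : TwoQubit) ξ X Y U)
    (hαβ : α ^ 2 + β ^ 2 = 1) :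
    reduced24 (cloneOutput (0, 0) ξ U (wernerLike p α β)) =
      partialTranspose (xState (3 / 10 + 3 / 5 / 2 * (p * (α ^ 2 - β ^ 2))) (1 / 5) (1 / 5)
        (3 / 10 - 3 / 5 / 2 * (p * (α ^ 2 - β ^ 2))) (1 / 10)) := by
  have h : (β : ℂ) ^ 2 = 1 - (α : ℂ) ^ 2 := by
    rw [eq_sub_iff_add_eq']; exact_mod_cast hαβ
  rw [wernerLike_eq_xState hαβ]
  ext ⟨i, i'⟩ ⟨j, j'⟩
  simp only [reduced24, Matrix.of_apply, Fin.sum_univ_two, hU.cloneOutput_apply]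
  fin_cases i <;> fin_cases i' <;> fin_cases j <;> fin_cases j' <;>
    simp [partialTranspose, xState, h]
  all_goals
    try ring

end Cloner

/-! ### The parameter ranges -/

/-- The parameter region is the entanglement condition of `wernerLike (3 / 5 * p) α β`: with
`β² = 1 - α²`, both say `144 p² (α² - 1/2)² < 27 p² + 30 p - 25 = (9 p - 5) (3 p + 5)`. -/
theorem inRegion_iff {p α β : ℝ} (hp₀ : 0 ≤ p) (hp₁ : p ≤ 1) (hαβ : α ^ 2 + β ^ 2 = 1) :
    InRegion p α ↔ ((1 - 3 / 5 * p) / 4) ^ 2 < (3 / 5 * p * (α * β)) ^ 2 := by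
  have hβ : β ^ 2 = 1 - α ^ 2 := by linarith
  have hexp : (3 / 5 * p * (α * β)) ^ 2 = 9 / 25 * p ^ 2 * (α ^ 2 * (1 - α ^ 2)) := by
    rw [← hβ]; ring
  rw [hexp]
  have hsqrt : Hminus p < α ^ 2 ∧ α ^ 2 < Hplus p ↔
      (α ^ 2 - 1 / 2) ^ 2 < (27 * p ^ 2 + 30 * p - 25) / (144 * p ^ 2) := by
    rw [Hminus, Hplus]
    refine Iff.trans ?_ Real.sq_lt.symm
    constructor <;> rintro ⟨_, _⟩ <;> constructor <;> linarith
  rw [InRegion, hsqrt]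
  rcases hp₀.eq_or_lt with rfl | hp
  · -- at `p = 0` both sides fail, whatever value the division by `0` takes
    norm_num
  · rw [lt_div_iff₀ (by positivity)]
    constructor
    · rintro ⟨_, _, h⟩
      nlinarith
    · intro h
      refine ⟨?_, hp₁, by nlinarith⟩
      -- `α² (1 - α²) ≤ 1/4` forces `(9 p - 5) (3 p + 5) > 0`
      have h4 : α ^ 2 * (1 - α ^ 2) ≤ 1 / 4 := by nlinarith [sq_nonneg (α ^ 2 - 1 / 2)]
      have := mul_le_mul_of_nonneg_left h4 (sq_nonneg p)
      nlinarith

theorem inSeparabilityRange_iff {p α : ℝ} (hp₀ : 0 ≤ p) (hp₁ : p ≤ 1) :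
    InSeparabilityRange p α ↔ p ^ 2 * (1 - 2 * α ^ 2) ^ 2 ≤ 8 / 9 := by
  have h2 : √2 * √2 = (2 : ℝ) := Real.mul_self_sqrt (by norm_num)
  have h2pos : 0 < √(2 : ℝ) := by positivity
  by_cases hmid : xiMinus < α ^ 2 ∧ α ^ 2 ≤ xiPlus
  · refine iff_of_true (Or.inr hmid) ?_
    obtain ⟨h₁, h₂⟩ := hmid
    rw [xiMinus] at h₁
    rw [xiPlus] at h₂
    have h : (1 - 2 * α ^ 2) ^ 2 ≤ 8 / 9 := by nlinarith
    have hp : p ^ 2 ≤ 1 := by nlinarith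
    nlinarith [mul_le_mul hp h (sq_nonneg _) zero_le_one]
  · have hout : α ^ 2 ≤ xiMinus ∨ xiPlus < α ^ 2 := by
      by_contra! hcon
      exact hmid ⟨hcon.1, hcon.2⟩
    -- the denominator under the square root vanishes only at `α² = 1/2`, strictly between `ξ₋`
    -- and `ξ₊`
    have hpos : 0 < (1 - 2 * α ^ 2) ^ 2 := by
      refine sq_pos_of_ne_zero fun h0 => ?_
      rcases hout with h | h
      · rw [xiMinus] at h; nlinarith
      · rw [xiPlus] at h; nlinarith
    rw [InSeparabilityRange, or_iff_left hmid, and_iff_left hout, Real.le_sqrt hp₀ (by positivity),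
      le_div_iff₀ (by positivity)]
    constructor <;> intro h <;> linarith

/-- Two corresponding qubits of the different clones are separable exactly when
`p |1 - 2α²| ≤ 2√2/3`. -/
theorem isSeparable_remaining_iff {p α β : ℝ} (hp₀ : 0 ≤ p) (hp₁ : p ≤ 1)
    (hαβ : α ^ 2 + β ^ 2 = 1) :
    IsSeparable (partialTranspose (xState (3 / 10 + 3 / 5 / 2 * (p * (α ^ 2 - β ^ 2)))
      (1 / 5) (1 / 5) (3 / 10 - 3 / 5 / 2 * (p * (α ^ 2 - β ^ 2))) (1 / 10))) ↔
      InSeparabilityRange p α := by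
  have hm : p * (α ^ 2 - β ^ 2) ≤ 1 := by nlinarith [sq_nonneg α, sq_nonneg β]
  have hm' : -1 ≤ p * (α ^ 2 - β ^ 2) := by nlinarith [sq_nonneg α, sq_nonneg β]
  rw [isSeparable_partialTranspose_iff, isSeparable_xState_iff (by linarith) (by norm_num)
    (by norm_num) (by linarith) (by ring), inSeparabilityRange_iff hp₀ hp₁,
    and_iff_left (by norm_num)]
  have hβ : β ^ 2 = 1 - α ^ 2 := by linarith
  rw [hβ]
  constructor <;> intro h <;> nlinarith

theorem InRegion.inSeparabilityRange {p α β : ℝ} (hp₀ : 0 ≤ p) (hαβ : α ^ 2 + β ^ 2 = 1)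
    (h : InRegion p α) : InSeparabilityRange p α := by
  have hp₁ := h.2.1
  have hr := (inRegion_iff hp₀ hp₁ hαβ).1 h
  rw [inSeparabilityRange_iff hp₀ hp₁]
  have hexp : (3 / 5 * p * (α * β)) ^ 2 = 9 / 25 * p ^ 2 * (α ^ 2 * (1 - α ^ 2)) := by
    rw [← eq_sub_iff_add_eq'.2 hαβ]; ring
  rw [hexp] at hr
  -- `hr` reads `p² (1 - 2α²)² < (27 p² + 30 p - 25) / 36`, and the right side is at most `8/9`
  nlinarith [h.1]

theorem InRegion.isEntangled_wernerLike {p α β : ℝ} (hp₀ : 0 ≤ p) (hαβ : α ^ 2 + β ^ 2 = 1)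
    (h : InRegion p α) : IsEntangled (wernerLike p α β) := by
  have hp₁ := h.2.1
  have hr := (inRegion_iff hp₀ hp₁ hαβ).1 h
  rw [isEntangled_wernerLike_iff hp₀ hp₁ hαβ]
  -- `1 - p ≤ 5/3 - p`, that is, the noise of the input is at most `5/3` of that of the clone
  have : ((1 - p) / 4) ^ 2 ≤ (25 / 9) * ((1 - 3 / 5 * p) / 4) ^ 2 := by nlinarith
  nlinarith

end BHBroadcast

theorem mainTheorem4 (p α β : ℝ) (hp₀ : 0 ≤ p) (hp₁ : p ≤ 1) (hαβ : α ^ 2 + β ^ 2 = 1)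
    {κ : Type*} [Fintype κ] [DecidableEq κ]
    (ξ : κ → ℂ) (X : BHBroadcast.TwoQubit → κ → ℂ)
    (Y : BHBroadcast.TwoQubit → BHBroadcast.TwoQubit → κ → ℂ)
    (U : Matrix ((BHBroadcast.TwoQubit × BHBroadcast.TwoQubit) × κ)
      ((BHBroadcast.TwoQubit × BHBroadcast.TwoQubit) × κ) ℂ)
    (hU : BHBroadcast.IsOptimalBHCloner ((0, 0) : BHBroadcast.TwoQubit) ξ X Y U)
    (τ : BHBroadcast.FourQubitMatrix)
    (hτ : τ = BHBroadcast.cloneOutput (0, 0) ξ U (BHBroadcast.wernerLike p α β)) :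
    -- the desired outputs and the remaining outputs, in Bloch form
    (BHBroadcast.reduced12 τ = BHBroadcast.blochState
        ((3 / 5 : ℝ) • BHBroadcast.wernerVec p α β) ((3 / 5 : ℝ) • BHBroadcast.wernerVec p α β)
        ((3 / 5 : ℝ) • BHBroadcast.wernerCorr p α β) ∧
      BHBroadcast.reduced34 τ = BHBroadcast.reduced12 τ ∧
      BHBroadcast.reduced13 τ = BHBroadcast.blochState
        ((3 / 5 : ℝ) • BHBroadcast.wernerVec p α β) ((3 / 5 : ℝ) • BHBroadcast.wernerVec p α β)
        ((1 / 5 : ℝ) • (1 : Matrix (Fin 3) (Fin 3) ℝ)) ∧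
      BHBroadcast.reduced24 τ = BHBroadcast.reduced13 τ) ∧
    -- the inseparability range of the desired outputs
    (BHBroadcast.IsEntangled (BHBroadcast.reduced12 τ) ↔ BHBroadcast.InRegion p α) ∧
    (BHBroadcast.IsEntangled (BHBroadcast.reduced34 τ) ↔ BHBroadcast.InRegion p α) ∧
    -- the separability range of the remaining outputs
    (BHBroadcast.IsSeparable (BHBroadcast.reduced13 τ) ↔ BHBroadcast.InSeparabilityRange p α) ∧
    (BHBroadcast.IsSeparable (BHBroadcast.reduced24 τ) ↔ BHBroadcast.InSeparabilityRange p α) ∧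
    -- in the broadcasting region the remaining outputs are separable
    (BHBroadcast.InRegion p α →
      BHBroadcast.IsSeparable (BHBroadcast.reduced13 τ) ∧
      BHBroadcast.IsSeparable (BHBroadcast.reduced24 τ)) ∧
    -- the optimal broadcasting range
    (BHBroadcast.IsBroadcastOptimally (BHBroadcast.wernerLike p α β) τ ↔
      BHBroadcast.InRegion p α) := by
  open BHBroadcast in
  subst hτ
  have h12 := hU.reduced12_wernerLike (p := p) hαβ
  have h34 : reduced34 (cloneOutput (0, 0) ξ U (wernerLike p α β)) =
      reduced12 (cloneOutput (0, 0) ξ U (wernerLike p α β)) := hU.traceLeft_cloneOutput _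
  have h13 := hU.reduced13_wernerLike (p := p) hαβ
  have h24 := hU.reduced24_wernerLike (p := p) hαβ
  have hent : IsEntangled (wernerLike (3 / 5 * p) α β) ↔ InRegion p α := by
    rw [isEntangled_wernerLike_iff (by linarith) (by linarith) hαβ, inRegion_iff hp₀ hp₁ hαβ]
  have hsep := isSeparable_remaining_iff hp₀ hp₁ hαβ
  rw [IsBroadcastOptimally, h34, h12, h13, h24, blochState_smul_werner, blochState_smul_one_eq,
    hent, hsep]
  refine ⟨⟨rfl, rfl, rfl, rfl⟩, Iff.rfl, Iff.rfl, Iff.rfl, Iff.rfl, fun h => ?_, fun h => h.2.1,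
    fun h => ?_⟩
  · have := h.inSeparabilityRange hp₀ hαβ
    exact ⟨this, this⟩
  · have := h.inSeparabilityRange hp₀ hαβ
    exact ⟨h.isEntangled_wernerLike hp₀ hαβ, h, h, this, this⟩
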